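/- Let $p_1,q_1,r_1,p_2,q_2,r_2$ be positive integers and let $L$ be the alternating link obtained as the closure of the 4-braid $$\beta=\sigma_1^{p_1}\sigma_2^{-q_1}\sigma_3^{r_1}\sigma_1^{p_2}\sigma_2^{-q_2}\sigma_3^{r_2}.$$ For a positive integer $n$ put $[n]=\frac{1-s^n}{1-s}=1+s+\dots+s^{n-1}$. Then the Alexander polynomial $\Delta_L(t)\in\mathbb{Z}[t^{1/2},t^{-1/2}]$, given by $\Delta_L(t)=\left(\frac{-1}{\sqrt t}\right)^{e_\beta-3}\frac{1-t}{1-t^4}\det\left(I_3-\psi_{4,t}(\beta)\right)$ where $\psi_{4,t}$ is the reduced Burau representation of $B_4$ and $e_\beta$ is the exponent sum of $\beta$, is equal, after the substitution $s=-t$ and up to multiplication by a unit of $\mathbb{Z}[t^{1/2},t^{-1/2}]$, to $$\Delta_L(s)=s[q_1][q_2]\bigl([p_1][p_2][r_1+r_2]+[r_1][r_2][p_1+p_2]\bigr)+[p_1+p_2][q_1+q_2][r_1+r_2].$$ Write this polynomial as $\sum_{k=0}^{n}a_ks^{k+r}$ with $a_0\neq 0\neq a_n$. Then all $a_k$ are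 nonzero, the polynomial is symmetric ($a_k=a_{n-k}$ for $0\le k\le n$), and it is trapezoidal: there are $0\le i\le j\le n$ with $$a_0<a_1<\dots<a_i=a_{i+1}=\dots=a_j>a_{j+1}>\dots>a_n .$$ Moreover, the length $l$ of its stable part, that is, the largest integer $l$ such that $a_{k_0}=a_{k_0+1}=\dots=a_{k_0+l}$ for some $k_0\geq 0$ with $k_0+l\le n$, satisfies $l\leq|\sigma(L)|$, where $\sigma(L)$ is the signature of $L$, i.e. the signature of $V+V^{T}$ for the Seifert matrix $V$ of the Seifert surface of the closed braid diagram of $\beta$. -/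

import Mathlib

/-! ### Braids -/

/-- Defining relations of the braid group with generators `σ_0, …, σ_{k-1}`. -/
def braidRels (k : ℕ) : Set (FreeGroup (Fin k)) :=
  {r | ∃ i j : Fin k, (i : ℕ) + 2 ≤ j ∧
      r = (FreeGroup.of i * FreeGroup.of j) * (FreeGroup.of j * FreeGroup.of i)⁻¹} ∪
  {r | ∃ i j : Fin k, (i : ℕ) + 1 = j ∧
      r = (FreeGroup.of i * FreeGroup.of j * FreeGroup.of i) *
        (FreeGroup.of j * FreeGroup.of i * FreeGroup.of j)⁻¹}

/-- Artin's braid group on `k + 1` strands, with its `k` standard generators. -/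
abbrev BraidGroup (k : ℕ) : Type := PresentedGroup (braidRels k)

/-- A braid word on `k + 1` strands: the letter `(i, true)` is the generator with index `i`
(a positive crossing between the strands in positions `i` and `i + 1`), and `(i, false)` is
its inverse (a negative crossing). Indices start at `0`. -/
abbrev BraidWord (k : ℕ) : Type := List (Fin k × Bool)

/-- The braid represented by a word. -/
def BraidWord.toBraid {k : ℕ} (w : BraidWord k) : BraidGroup k :=
  PresentedGroup.mk (braidRels k) (FreeGroup.mk w)

/-- The exponent sum of a braid, as a homomorphism to the integers. -/
def braidExponentHom (k : ℕ) : BraidGroup k →* Multiplicative ℤ :=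
  PresentedGroup.toGroup (rels := braidRels k) (f := fun _ => Multiplicative.ofAdd (1 : ℤ)) (by
    rintro r (⟨i, j, -, rfl⟩ | ⟨i, j, -, rfl⟩) <;> simp)

/-- The exponent sum `e_b` of a braid `b`. -/
def braidExponentSum {k : ℕ} (b : BraidGroup k) : ℤ :=
  Multiplicative.toAdd (braidExponentHom k b)

/-! ### The reduced Burau representation of the braid group on four strands -/

section Burau

variable {R : Type*} [CommRing R]

/-- The reduced Burau matrices of the three generators. -/
def burauMatrix (t : Rˣ) : Fin 3 → Matrix (Fin 3) (Fin 3) R :=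
  ![!![-(t : R), 1, 0; 0, 1, 0; 0, 0, 1],
    !![1, 0, 0; (t : R), -(t : R), 1; 0, 0, 1],
    !![1, 0, 0; 0, 1, 0; 0, (t : R), -(t : R)]]

/-- The inverses of the reduced Burau matrices. -/
def burauMatrixInv (t : Rˣ) : Fin 3 → Matrix (Fin 3) (Fin 3) R :=
  ![!![-((t⁻¹ : Rˣ) : R), ((t⁻¹ : Rˣ) : R), 0; 0, 1, 0; 0, 0, 1],
    !![1, 0, 0; 1, -((t⁻¹ : Rˣ) : R), ((t⁻¹ : Rˣ) : R); 0, 0, 1],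
    !![1, 0, 0; 0, 1, 0; 0, 1, -((t⁻¹ : Rˣ) : R)]]

theorem burauMatrix_mul_inv (t : Rˣ) (i : Fin 3) :
    burauMatrix t i * burauMatrixInv t i = 1 := by
  fin_cases i <;> ext a b <;> fin_cases a <;> fin_cases b <;>
    simp [burauMatrix, burauMatrixInv, Matrix.mul_apply, Fin.sum_univ_three]

theorem burauMatrixInv_mul (t : Rˣ) (i : Fin 3) :
    burauMatrixInv t i * burauMatrix t i = 1 :=
  mul_eq_one_comm.mp (burauMatrix_mul_inv t i)

/-- The reduced Burau matrices as elements of `GL₃`. -/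
def burauGen (t : Rˣ) (i : Fin 3) : GL (Fin 3) R :=
  ⟨burauMatrix t i, burauMatrixInv t i, burauMatrix_mul_inv t i, burauMatrixInv_mul t i⟩

theorem burauGen_rels (t : Rˣ) :
    ∀ r ∈ braidRels 3, FreeGroup.lift (burauGen t) r = 1 := by
  rintro r (⟨i, j, h, rfl⟩ | ⟨i, j, h, rfl⟩)
  · simp only [map_mul, map_inv, FreeGroup.lift_apply_of, mul_inv_eq_one]
    apply Units.ext
    fin_cases i <;> fin_cases j <;> simp at h
    ext a b; fin_cases a <;> fin_cases b <;>
      simp [burauGen, burauMatrix, Matrix.mul_apply, Fin.sum_univ_three]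
  · simp only [map_mul, map_inv, FreeGroup.lift_apply_of, mul_inv_eq_one]
    apply Units.ext
    fin_cases i <;> fin_cases j <;> simp at h <;> ext a b <;> fin_cases a <;> fin_cases b <;>
      simp [burauGen, burauMatrix, Matrix.mul_apply, Fin.sum_univ_three]

/-- The reduced Burau representation of the braid group on four strands. -/
def burau (t : Rˣ) : BraidGroup 3 →* GL (Fin 3) R :=
  PresentedGroup.toGroup (burauGen_rels t)

/-- Modulo `1 + t + t² + t³` the representation fixes the vector `(1, 1 + t, 1 + t + t²)`. -/
theorem burau_fixes (t : Rˣ) (b : BraidGroup 3) :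
    ∃ y : Fin 3 → R,
      (burau t b : Matrix (Fin 3) (Fin 3) R).mulVec
          ![1, 1 + (t : R), 1 + (t : R) + (t : R) ^ 2] =
        ![1, 1 + (t : R), 1 + (t : R) + (t : R) ^ 2] +
          (1 + (t : R) + (t : R) ^ 2 + (t : R) ^ 3) • y := by
  have hb : b ∈ Subgroup.closure (Set.range (PresentedGroup.of (rels := braidRels 3))) := by
    rw [PresentedGroup.closure_range_of]; trivial
  induction hb using Subgroup.closure_induction with
  | mem x hx =>
    obtain ⟨i, rfl⟩ := hx
    refine ⟨![0, 0, if i = 2 then -1 else 0], ?_⟩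
    rw [burau, PresentedGroup.toGroup.of]
    fin_cases i <;> ext a <;> fin_cases a <;>
      simp [burauGen, burauMatrix, Matrix.mulVec, dotProduct, Fin.sum_univ_three] <;> ring
  | one => exact ⟨0, by simp⟩
  | mul x y _ _ hx hy =>
    obtain ⟨u, hu⟩ := hx
    obtain ⟨v, hv⟩ := hy
    refine ⟨u + (burau t x : Matrix (Fin 3) (Fin 3) R).mulVec v, ?_⟩
    rw [map_mul, Units.val_mul, ← Matrix.mulVec_mulVec, hv, Matrix.mulVec_add, hu,
      Matrix.mulVec_smul, smul_add, add_assoc]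
  | inv x _ hx =>
    obtain ⟨u, hu⟩ := hx
    refine ⟨-((burau t x)⁻¹ : GL (Fin 3) R).val.mulVec u, ?_⟩
    have h := congrArg (((burau t x)⁻¹ : GL (Fin 3) R).val.mulVec) hu
    rw [Matrix.mulVec_mulVec, Units.inv_mul, Matrix.one_mulVec, Matrix.mulVec_add,
      Matrix.mulVec_smul] at h
    rw [map_inv, smul_neg, ← sub_eq_add_neg, eq_sub_iff_add_eq, ← h]

theorem burau_dvd (t : Rˣ) (b : BraidGroup 3) :
    (1 + (t : R) + (t : R) ^ 2 + (t : R) ^ 3) ∣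
      (1 - (burau t b : Matrix (Fin 3) (Fin 3) R)).det := by
  obtain ⟨y, hy⟩ := burau_fixes t b
  have h : (1 - (burau t b : Matrix (Fin 3) (Fin 3) R)).mulVec
      ![1, 1 + (t : R), 1 + (t : R) + (t : R) ^ 2] =
        (1 + (t : R) + (t : R) ^ 2 + (t : R) ^ 3) • (-y) := by
    rw [Matrix.sub_mulVec, Matrix.one_mulVec, hy, smul_neg]; abel
  have h2 := congrArg
    ((1 - (burau t b : Matrix (Fin 3) (Fin 3) R)).adjugate.mulVec) h
  rw [Matrix.mulVec_mulVec, Matrix.adjugate_mul, Matrix.smul_mulVec, Matrix.one_mulVec,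
    Matrix.mulVec_smul] at h2
  have h3 := congrFun h2 0
  simp only [Pi.smul_apply, smul_eq_mul, Matrix.cons_val_zero, mul_one] at h3
  exact ⟨_, h3⟩

end Burau

/-! ### The Alexander polynomial of a closed 4-braid -/

/-- The element `√t` of `ℤ[t^{1/2}, t^{-1/2}]`, which is modelled as the ring of integral
Laurent polynomials in the variable `T 1 = √t`. -/
noncomputable def sqrtT : (LaurentPolynomial ℤ)ˣ where
  val := LaurentPolynomial.T 1
  inv := LaurentPolynomial.T (-1)
  val_inv := by rw [← LaurentPolynomial.T_add]; simp
  inv_val := by rw [← LaurentPolynomial.T_add]; simp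

/-- The element `t` of `ℤ[t^{1/2}, t^{-1/2}]`. -/
noncomputable def tVar : (LaurentPolynomial ℤ)ˣ := sqrtT ^ 2

/-- The Alexander polynomial of the closure of a 4-braid `b`, as an element of
`ℤ[t^{1/2}, t^{-1/2}]`:
`(-1/√t)^(e_b - 3) * (1 - t)/(1 - t⁴) * det (I₃ - ψ_t(b))`, with `ψ_t` the reduced Burau
representation. The factor `(1 - t)/(1 - t⁴)` is division by `1 + t + t² + t³`, which always
divides the determinant; see `alexanderPolynomial_spec`. -/
noncomputable def alexanderPolynomial (b : BraidGroup 3) : LaurentPolynomial ℤ :=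
  (((-sqrtT⁻¹) ^ (braidExponentSum b - 3) : (LaurentPolynomial ℤ)ˣ) : LaurentPolynomial ℤ) *
    Classical.choose (burau_dvd tVar b)

theorem alexanderPolynomial_spec (b : BraidGroup 3) :
    (1 - (tVar : LaurentPolynomial ℤ) ^ 4) * alexanderPolynomial b =
      (((-sqrtT⁻¹) ^ (braidExponentSum b - 3) : (LaurentPolynomial ℤ)ˣ) : LaurentPolynomial ℤ) *
        ((1 - (tVar : LaurentPolynomial ℤ)) *
          (1 - (burau tVar b : Matrix (Fin 3) (Fin 3) (LaurentPolynomial ℤ))).det) := by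
  rw [Classical.choose_spec (burau_dvd tVar b), alexanderPolynomial]
  ring

/-! ### The signature of a closed braid -/

namespace BraidWord

variable {k : ℕ} (w : BraidWord k)

/-- The sign `±1` of the crossing at position `a` of the word. -/
def crossingSign (a : Fin w.length) : ℤ := if (w.get a).2 then 1 else -1

/-- Seifert's algorithm applied to the closure of the word gives a surface made of `k + 1`
stacked discs and one half-twisted band for each letter, a letter with index `i` joining the
discs `i` and `i + 1`. A basis of its first homology is given by the loops which run up one band
and down the next band between the same two discs: they correspond to the pairs `a < b` of
positions with the same index `i` such that `i` does not occur strictly between `a` and `b`. -/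
abbrev SeifertLoop : Type :=
  {x : Fin w.length × Fin w.length //
    x.1 < x.2 ∧ (w.get x.1).1 = (w.get x.2).1 ∧
      ∀ c, x.1 < c → c < x.2 → (w.get c).1 ≠ (w.get x.1).1}

/-- The index of the generator to which the bands of a loop belong. -/
def SeifertLoop.column {w : BraidWord k} (x : w.SeifertLoop) : Fin k := (w.get x.1.1).1

/-- The Seifert matrix of the closed braid: its entries are the linking numbers `lk (x⁺, y)`,
where `x⁺` is the push-off of the loop `x` in the positive normal direction.

* A loop through two bands with signs `ε` and `ε'` has self-linking `-(ε + ε') / 2`.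
* If `x` and `y` lie in the same column and the last band of `x` is the first band of `y`, then
  `lk (x⁺, y) = 1` and `lk (y⁺, x) = 0` when that band is positive, while
  `lk (x⁺, y) = 0` and `lk (y⁺, x) = -1` when it is negative.
* If `x` lies in column `i` and `y` in column `i + 1`, then `x⁺` and `y` are linked exactly when
  the endpoints of the two loops interleave, and `lk (y⁺, x) = 0`.
* All other linking numbers vanish. -/
def seifertMatrix : Matrix w.SeifertLoop w.SeifertLoop ℤ := fun x y =>
  if x = y then -((w.crossingSign x.1.1 + w.crossingSign x.1.2) / 2)
  else if x.1.2 = y.1.1 then (if w.crossingSign x.1.2 = 1 then 1 else 0)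
  else if y.1.2 = x.1.1 then (if w.crossingSign x.1.1 = 1 then 0 else -1)
  else if (x.column : ℕ) + 1 = y.column then
    (if x.1.1 < y.1.1 ∧ y.1.1 < x.1.2 ∧ x.1.2 < y.1.2 then -1
     else if y.1.1 < x.1.1 ∧ x.1.1 < y.1.2 ∧ y.1.2 < x.1.2 then 1
     else 0)
  else 0

/-- The signature of the closure of a braid word: the number of positive minus the number of
negative eigenvalues of the symmetrized Seifert matrix `V + Vᵀ`. -/
noncomputable def signature : ℤ :=
  let Q : QuadraticForm ℝ (w.SeifertLoop → ℝ) :=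
    ((w.seifertMatrix + w.seifertMatrix.transpose).map (Int.cast : ℤ → ℝ)).toQuadraticForm'
  (sigPos Q : ℤ) - (sigNeg Q : ℤ)

end BraidWord

/-! ### Symmetric and trapezoidal polynomials

A nonzero polynomial is written as `p = ∑_{k=0}^{n} a_k s^(k+r)` with `a_0 ≠ 0` and `a_n ≠ 0`. -/

namespace Polynomial

/-- The number `n` in `p = ∑_{k=0}^{n} a_k s^(k+r)`. -/
def span (p : Polynomial ℤ) : ℕ := p.natDegree - p.natTrailingDegree

/-- The coefficient `a_k` in `p = ∑_{k=0}^{n} a_k s^(k+r)`. -/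
def shiftedCoeff (p : Polynomial ℤ) (k : ℕ) : ℤ := p.coeff (k + p.natTrailingDegree)

/-- `a_k = a_{n-k}` for all `0 ≤ k ≤ n`. -/
def IsSymmetric (p : Polynomial ℤ) : Prop :=
  ∀ k ≤ p.span, p.shiftedCoeff k = p.shiftedCoeff (p.span - k)

/-- `a_0 < ⋯ < a_i = ⋯ = a_j > ⋯ > a_n` for some `0 ≤ i ≤ j ≤ n`. -/
def IsTrapezoidal (p : Polynomial ℤ) : Prop :=
  ∃ i j : ℕ, i ≤ j ∧ j ≤ p.span ∧
    (∀ k < i, p.shiftedCoeff k < p.shiftedCoeff (k + 1)) ∧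
    (∀ k, i ≤ k → k < j → p.shiftedCoeff k = p.shiftedCoeff (k + 1)) ∧
    (∀ k, j ≤ k → k < p.span → p.shiftedCoeff (k + 1) < p.shiftedCoeff k)

/-- `l` is the length of the stable part of `p`: the largest `l` such that
`a_{k₀} = a_{k₀+1} = ⋯ = a_{k₀+l}` for some `k₀`, where `k₀ + l ≤ n`. -/
def IsStableLength (p : Polynomial ℤ) (l : ℕ) : Prop :=
  IsGreatest {l : ℕ | ∃ k₀ : ℕ, k₀ + l ≤ p.span ∧
    ∀ m ≤ l, p.shiftedCoeff (k₀ + m) = p.shiftedCoeff k₀} l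

end Polynomial

/-! ### The two-block alternating 4-braids -/

/-- `[n] = 1 + s + ⋯ + s^(n-1) = (1 - s^n)/(1 - s)`. -/
noncomputable def qInt (n : ℕ) : Polynomial ℤ := ∑ i ∈ Finset.range n, Polynomial.X ^ i

/-- The word `σ₁^{p₁} σ₂^{-q₁} σ₃^{r₁} σ₁^{p₂} σ₂^{-q₂} σ₃^{r₂}`. -/
def twoBlockWord (p₁ q₁ r₁ p₂ q₂ r₂ : ℕ) : BraidWord 3 :=
  List.replicate p₁ (0, true) ++ List.replicate q₁ (1, false) ++ List.replicate r₁ (2, true) ++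
    List.replicate p₂ (0, true) ++ List.replicate q₂ (1, false) ++ List.replicate r₂ (2, true)

/-- `s[q₁][q₂]([p₁][p₂][r₁+r₂] + [r₁][r₂][p₁+p₂]) + [p₁+p₂][q₁+q₂][r₁+r₂]`. -/
noncomputable def twoBlockPolynomial (p₁ q₁ r₁ p₂ q₂ r₂ : ℕ) : Polynomial ℤ :=
  Polynomial.X * qInt q₁ * qInt q₂ *
      (qInt p₁ * qInt p₂ * qInt (r₁ + r₂) + qInt r₁ * qInt r₂ * qInt (p₁ + p₂)) +
    qInt (p₁ + p₂) * qInt (q₁ + q₂) * qInt (r₁ + r₂)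

/-! ### The reduced Burau matrices of powers of the generators -/

/-! Put `s = -t`. Each power of a Burau generator, or of its inverse, is governed by a single
geometric sum, because `s ^ n = 1 - (1 - s)[n]`. Hence `det (1 - ψ(β))` is a polynomial identity in
six parameters (`det_one_sub_twoBlock`), and the addition rule for `[m + n]` turns it into the
two-block polynomial times `1 + t + t² + t³` and a unit.

For the shape, multiplication by `[m]` preserves symmetric trapezoids (`IsSymmTrapezoid.sum_shift`),
and so does adding sequences with a common centre. The three summands of the polynomial share their
centre, and adding the other two can only shorten the plateau of `[p₁+p₂][q₁+q₂][r₁+r₂]`, whose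
length is explicit.

For the signature, adjacent columns of an alternating word have opposite signs. The symmetrized
Seifert form is therefore definite on the loops of each sign, where it is plus or minus a Gram
matrix of independent vectors. Counting loops gives `(q₁+q₂-1) - (p₁+p₂-1) - (r₁+r₂-1)`, whose
absolute value bounds the plateau. -/

theorem BraidWord.toBraid_append {k : ℕ} (w w' : BraidWord k) :
    BraidWord.toBraid (w ++ w') = w.toBraid * w'.toBraid := by
  rw [BraidWord.toBraid, BraidWord.toBraid, BraidWord.toBraid, ← map_mul, FreeGroup.mul_mk]

theorem BraidWord.toBraid_replicate_true {k : ℕ} (n : ℕ) (i : Fin k) :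
    BraidWord.toBraid (List.replicate n (i, true)) = PresentedGroup.of i ^ n := by
  induction n with
  | zero => exact map_one _
  | succ n ih =>
    rw [List.replicate_succ', BraidWord.toBraid_append, ih, pow_succ]
    rfl

theorem BraidWord.toBraid_replicate_false {k : ℕ} (n : ℕ) (i : Fin k) :
    BraidWord.toBraid (List.replicate n (i, false)) = (PresentedGroup.of i)⁻¹ ^ n := by
  induction n with
  | zero => exact map_one _
  | succ n ih =>
    rw [List.replicate_succ', BraidWord.toBraid_append, ih, pow_succ]
    rfl

section Burau

variable {R : Type*} [CommRing R]

theorem burau_of (t : Rˣ) (i : Fin 3) : burau t (PresentedGroup.of i) = burauGen t i :=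
  PresentedGroup.toGroup.of _

theorem burau_of_pow_val (t : Rˣ) (i : Fin 3) (n : ℕ) :
    (burau t (PresentedGroup.of i ^ n) : Matrix (Fin 3) (Fin 3) R) = burauMatrix t i ^ n := by
  rw [map_pow, Units.val_pow_eq_pow_val, burau_of]
  rfl

theorem burau_of_inv_pow_val (t : Rˣ) (i : Fin 3) (n : ℕ) :
    (burau t ((PresentedGroup.of i)⁻¹ ^ n) : Matrix (Fin 3) (Fin 3) R) =
      burauMatrixInv t i ^ n := by
  rw [map_pow, Units.val_pow_eq_pow_val, map_inv, burau_of]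
  rfl

theorem burauMatrix_zero_pow (t : Rˣ) (n : ℕ) :
    burauMatrix t 0 ^ n =
      !![(-(t : R)) ^ n, ∑ i ∈ Finset.range n, (-(t : R)) ^ i, 0; 0, 1, 0; 0, 0, 1] := by
  induction n with
  | zero => ext a b; fin_cases a <;> fin_cases b <;> simp
  | succ n ih =>
    rw [pow_succ, ih]
    ext a b; fin_cases a <;> fin_cases b <;>
      simp [burauMatrix, Matrix.mul_apply, Fin.sum_univ_three, Finset.sum_range_succ] <;> ring

theorem burauMatrix_two_pow (t : Rˣ) (n : ℕ) :
    burauMatrix t 2 ^ n =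
      !![1, 0, 0; 0, 1, 0;
        0, (t : R) * ∑ i ∈ Finset.range n, (-(t : R)) ^ i, (-(t : R)) ^ n] := by
  induction n with
  | zero => ext a b; fin_cases a <;> fin_cases b <;> simp
  | succ n ih =>
    rw [pow_succ', ih]
    ext a b; fin_cases a <;> fin_cases b <;>
      simp [burauMatrix, Matrix.mul_apply, Fin.sum_univ_three, Finset.sum_range_succ',
        pow_succ, ← Finset.sum_mul] <;> ring

/-- The natural entry is the sum of `s⁻¹, …, s⁻ⁿ` with `s = -t`. It is written as `s⁻ⁿ[n]`, so that
the same `[n]` occurs as for the positive generators. -/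
theorem burauMatrixInv_one_pow (t : Rˣ) (n : ℕ) :
    burauMatrixInv t 1 ^ n =
      !![1, 0, 0;
        -(t : R) * ((-((t⁻¹ : Rˣ) : R)) ^ n * ∑ i ∈ Finset.range n, (-(t : R)) ^ i),
          (-((t⁻¹ : Rˣ) : R)) ^ n,
          -((-((t⁻¹ : Rˣ) : R)) ^ n * ∑ i ∈ Finset.range n, (-(t : R)) ^ i);
        0, 0, 1] := by
  have h : -((t⁻¹ : Rˣ) : R) * -(t : R) = 1 := by simp
  induction n with
  | zero => ext a b; fin_cases a <;> fin_cases b <;> simp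
  | succ n ih =>
    have hn : (-((t⁻¹ : Rˣ) : R)) ^ n * (-(t : R)) ^ n = 1 := by rw [← mul_pow, h, one_pow]
    rw [pow_succ', ih]
    ext a b; fin_cases a <;> fin_cases b <;>
      simp only [burauMatrixInv, Matrix.mul_apply, Fin.sum_univ_three, Finset.sum_range_succ,
        pow_succ] <;> simp
    · linear_combination -(t : R) * ((t⁻¹ : Rˣ) : R) * hn -
        (1 + (-((t⁻¹ : Rˣ) : R)) ^ n * ∑ i ∈ Finset.range n, (-(t : R)) ^ i) * h
    · ring
    · linear_combination -((t⁻¹ : Rˣ) : R) * hn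

/-- The determinant of the identity minus a product of six matrices of the shape of powers of
the reduced Burau matrices at `t = -s`. -/
theorem det_one_sub_twoBlock (s x₁ x₂ w₁ w₂ z₁ z₂ : R) :
    (1 - !![1 - (1 - s) * x₁, x₁, 0; 0, 1, 0; 0, 0, 1] *
        !![1, 0, 0; -s * w₁, 1 - (1 - s) * w₁, w₁; 0, 0, 1] *
        !![1, 0, 0; 0, 1, 0; 0, -s * z₁, 1 - (1 - s) * z₁] *
        !![1 - (1 - s) * x₂, x₂, 0; 0, 1, 0; 0, 0, 1] *
        !![1, 0, 0; -s * w₂, 1 - (1 - s) * w₂, w₂; 0, 0, 1] *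
        !![1, 0, 0; 0, 1, 0; 0, -s * z₂, 1 - (1 - s) * z₂]).det =
      -(1 - s + s ^ 2 - s ^ 3) *
        (s * w₁ * w₂ * (x₁ * x₂ * (z₁ + z₂ - (1 - s) * z₁ * z₂) +
          z₁ * z₂ * (x₁ + x₂ - (1 - s) * x₁ * x₂)) -
        (x₁ + x₂ - (1 - s) * x₁ * x₂) * (z₁ + z₂ - (1 - s) * z₁ * z₂) *
          (w₁ + w₂ - (1 - s) * w₁ * w₂)) := by
  simp only [Matrix.mul_fin_three, Matrix.one_fin_three, Matrix.sub_apply, Matrix.det_fin_three,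
    Matrix.of_apply, Matrix.cons_val', Matrix.cons_val_zero, Matrix.cons_val_one,
    Matrix.cons_val, Matrix.cons_val_fin_one]
  ring

end Burau

/-! ### The Alexander polynomial of the two-block braids -/

section Burau

variable {R : Type*} [CommRing R]

theorem aeval_qInt (s : R) (n : ℕ) :
    Polynomial.aeval s (qInt n) = ∑ i ∈ Finset.range n, s ^ i := by
  simp [qInt]

theorem one_sub_mul_sum_pow (s : R) (n : ℕ) :
    (1 - s) * ∑ i ∈ Finset.range n, s ^ i = 1 - s ^ n := by
  linear_combination -(mul_geom_sum s n)

/-- This is the combination `x₁ + x₂ - (1 - s) x₁ x₂` that occurs in `det_one_sub_twoBlock`. -/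
theorem sum_pow_range_add (s : R) (m n : ℕ) :
    ∑ i ∈ Finset.range (m + n), s ^ i = ∑ i ∈ Finset.range m, s ^ i +
      ∑ i ∈ Finset.range n, s ^ i -
        (1 - s) * (∑ i ∈ Finset.range m, s ^ i) * ∑ i ∈ Finset.range n, s ^ i := by
  rw [one_sub_mul_sum_pow, Finset.sum_range_add]
  simp only [pow_add, ← Finset.mul_sum]
  ring

theorem det_one_sub_burau_twoBlockWord (t : Rˣ) (p₁ q₁ r₁ p₂ q₂ r₂ : ℕ) :
    (1 - (burau t (twoBlockWord p₁ q₁ r₁ p₂ q₂ r₂).toBraid : Matrix (Fin 3) (Fin 3) R)).det =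
      (1 + (t : R) + (t : R) ^ 2 + (t : R) ^ 3) *
        (-((-((t⁻¹ : Rˣ) : R)) ^ (q₁ + q₂)) *
          Polynomial.aeval (-(t : R)) (twoBlockPolynomial p₁ q₁ r₁ p₂ q₂ r₂)) := by
  have h : -((t⁻¹ : Rˣ) : R) * -(t : R) = 1 := by simp
  have hpow : ∀ n : ℕ, (-(t : R)) ^ n =
      1 - (1 - -(t : R)) * ∑ i ∈ Finset.range n, (-(t : R)) ^ i := fun n => by
    rw [one_sub_mul_sum_pow]; ring
  have hinv : ∀ n : ℕ, (-((t⁻¹ : Rˣ) : R)) ^ n = 1 - (1 - -(t : R)) *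
      -((-((t⁻¹ : Rˣ) : R)) ^ n * ∑ i ∈ Finset.range n, (-(t : R)) ^ i) := fun n => by
    have hn : (-((t⁻¹ : Rˣ) : R)) ^ n * (-(t : R)) ^ n = 1 := by rw [← mul_pow, h, one_pow]
    linear_combination hn - (-((t⁻¹ : Rˣ) : R)) ^ n * one_sub_mul_sum_pow (-(t : R)) n
  have hP : ∀ n : ℕ, burauMatrix t 0 ^ n =
      !![1 - (1 - -(t : R)) * ∑ i ∈ Finset.range n, (-(t : R)) ^ i,
        ∑ i ∈ Finset.range n, (-(t : R)) ^ i, 0; 0, 1, 0; 0, 0, 1] := fun n => by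
    rw [burauMatrix_zero_pow, ← hpow]
  have hR : ∀ n : ℕ, burauMatrix t 2 ^ n =
      !![1, 0, 0; 0, 1, 0; 0, -(-(t : R)) * ∑ i ∈ Finset.range n, (-(t : R)) ^ i,
        1 - (1 - -(t : R)) * ∑ i ∈ Finset.range n, (-(t : R)) ^ i] := fun n => by
    rw [burauMatrix_two_pow, ← hpow, neg_neg]
  have hQ : ∀ n : ℕ, burauMatrixInv t 1 ^ n =
      !![1, 0, 0; -(-(t : R)) *
          -((-((t⁻¹ : Rˣ) : R)) ^ n * ∑ i ∈ Finset.range n, (-(t : R)) ^ i),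
        1 - (1 - -(t : R)) *
          -((-((t⁻¹ : Rˣ) : R)) ^ n * ∑ i ∈ Finset.range n, (-(t : R)) ^ i),
        -((-((t⁻¹ : Rˣ) : R)) ^ n * ∑ i ∈ Finset.range n, (-(t : R)) ^ i);
        0, 0, 1] := fun n => by
    rw [burauMatrixInv_one_pow, ← hinv, neg_neg, mul_neg, neg_mul]
  rw [twoBlockWord, BraidWord.toBraid_append, BraidWord.toBraid_append, BraidWord.toBraid_append,
    BraidWord.toBraid_append, BraidWord.toBraid_append]
  simp only [BraidWord.toBraid_replicate_true, BraidWord.toBraid_replicate_false]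
  simp only [map_mul, Units.val_mul, burau_of_pow_val, burau_of_inv_pow_val]
  rw [hP, hP, hQ, hQ, hR, hR, det_one_sub_twoBlock]
  simp only [twoBlockPolynomial, map_add, map_mul, Polynomial.aeval_X, aeval_qInt]
  rw [sum_pow_range_add _ p₁, sum_pow_range_add _ r₁, sum_pow_range_add _ q₁, pow_add]
  -- Once the sums and powers become free variables, these are the only relations still needed
  -- between `s^(-q)` and `[q]`.
  have h₁ := hinv q₁
  have h₂ := hinv q₂
  generalize ∑ i ∈ Finset.range p₁, (-(t : R)) ^ i = x₁
  generalize ∑ i ∈ Finset.range p₂, (-(t : R)) ^ i = x₂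
  generalize ∑ i ∈ Finset.range r₁, (-(t : R)) ^ i = z₁
  generalize ∑ i ∈ Finset.range r₂, (-(t : R)) ^ i = z₂
  generalize ∑ i ∈ Finset.range q₁, (-(t : R)) ^ i = y₁ at h₁ ⊢
  generalize ∑ i ∈ Finset.range q₂, (-(t : R)) ^ i = y₂ at h₂ ⊢
  generalize (-((t⁻¹ : Rˣ) : R)) ^ q₁ = v₁ at h₁ ⊢
  generalize (-((t⁻¹ : Rˣ) : R)) ^ q₂ = v₂ at h₂ ⊢
  -- The addition rule for the parameters `-s^(-q)[q]` of the inverse generator, up to an overall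
  -- sign.
  have key : v₁ * y₁ * (1 + (1 - -(t : R)) * (v₂ * y₂)) + v₂ * y₂ =
      v₁ * v₂ * (y₁ + y₂ - (1 - -(t : R)) * y₁ * y₂) := by
    linear_combination (-v₁ * y₁) * h₂ - (v₂ * y₂) * h₁
  linear_combination (-(1 + (t : R) + (t : R) ^ 2 + (t : R) ^ 3)) *
    (x₁ + x₂ - (1 - -(t : R)) * x₁ * x₂) * (z₁ + z₂ - (1 - -(t : R)) * z₁ * z₂) * key

end Burau

theorem one_add_tVar_add_sq_add_cube_ne_zero :
    1 + (tVar : LaurentPolynomial ℤ) + (tVar : LaurentPolynomial ℤ) ^ 2 +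
      (tVar : LaurentPolynomial ℤ) ^ 3 ≠ 0 := by
  intro h
  have hT : (tVar : LaurentPolynomial ℤ) = LaurentPolynomial.T 2 := by
    simp [tVar, sqrtT, LaurentPolynomial.T_pow]
  -- At `√t = 1` the sum equals 4.
  have h1 := congrArg (LaurentPolynomial.eval₂ (RingHom.id ℤ) 1) h
  simp [hT] at h1

/-- Cancelling `1 + t + t² + t³` in the Laurent polynomial ring identifies the chosen quotient; all
remaining factors are units. -/
theorem associated_alexanderPolynomial_twoBlockWord (p₁ q₁ r₁ p₂ q₂ r₂ : ℕ) :
    Associated (alexanderPolynomial (twoBlockWord p₁ q₁ r₁ p₂ q₂ r₂).toBraid)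
      (Polynomial.aeval (-(tVar : LaurentPolynomial ℤ))
        (twoBlockPolynomial p₁ q₁ r₁ p₂ q₂ r₂)) := by
  have hspec := (det_one_sub_burau_twoBlockWord tVar p₁ q₁ r₁ p₂ q₂ r₂).symm.trans
    (Classical.choose_spec (burau_dvd tVar (twoBlockWord p₁ q₁ r₁ p₂ q₂ r₂).toBraid))
  have hc := mul_left_cancel₀ one_add_tVar_add_sq_add_cube_ne_zero hspec
  rw [alexanderPolynomial, ← hc, ← mul_assoc]
  refine associated_unit_mul_left _ _ ((Units.isUnit _).mul ?_)
  exact ((tVar⁻¹).isUnit.neg.pow (q₁ + q₂)).neg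

/-! ### Symmetric trapezoidal sequences -/

/-- The sequence `f` is supported on `{0, …, c}`, symmetric about `c / 2`, strictly increasing on
`{-1, 0, …, i}` and constant on `{i, …, c - i}`. -/
structure IsSymmTrapezoid (f : ℤ → ℤ) (c i : ℤ) : Prop where
  nonneg : 0 ≤ i
  two_mul_le : 2 * i ≤ c
  zero : ∀ k < 0, f k = 0
  symm : ∀ k, f (c - k) = f k
  rise : ∀ k, 0 ≤ k → k ≤ i → f (k - 1) < f k
  flat : ∀ k, i < k → 2 * k ≤ c + 1 → f (k - 1) = f k

namespace IsSymmTrapezoid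

variable {f g : ℤ → ℤ} {c i i' : ℤ}

/-- The bound `2 * k ≤ c + 1` includes, for odd `c`, the step across the centre, between two values
that are equal by symmetry. -/
theorem step_le (h : IsSymmTrapezoid f c i) {k : ℤ} (hk : 2 * k ≤ c + 1) : f (k - 1) ≤ f k := by
  rcases lt_or_ge k 0 with h0 | h0
  · rw [h.zero k h0, h.zero (k - 1) (by omega)]
  · rcases le_or_gt k i with hi | hi
    · exact (h.rise k h0 hi).le
    · exact (h.flat k hi hk).le

theorem mono (h : IsSymmTrapezoid f c i) {a b : ℤ} (hab : a ≤ b) (hb : 2 * b ≤ c + 1) :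
    f a ≤ f b := by
  induction b, hab using Int.leInduction with
  | base => exact le_rfl
  | succ b hab ih =>
    have := h.step_le hb
    rw [add_sub_cancel_right] at this
    exact (ih (by omega)).trans this

theorem lt (h : IsSymmTrapezoid f c i) {a b : ℤ} (hab : a < b) (hb : 2 * b ≤ c + 1) (hb0 : 0 ≤ b)
    (ha : a < i) : f a < f b := by
  have h1 := h.two_mul_le
  have h2 := h.nonneg
  -- Strict growth only starts at `-1`, so a more negative `a` is first moved there.
  calc f a ≤ f (max a (-1)) := h.mono (le_max_left _ _) (by omega)
    _ < f (max a (-1) + 1) := by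
      have := h.rise (max a (-1) + 1) (by omega) (by omega)
      rwa [add_sub_cancel_right] at this
    _ ≤ f b := h.mono (by omega) hb

theorem eq_of_le (h : IsSymmTrapezoid f c i) {a b : ℤ} (ha : i ≤ a) (hab : a ≤ b)
    (hb : 2 * b ≤ c + 1) : f a = f b := by
  induction b, hab using Int.leInduction with
  | base => rfl
  | succ b hab ih =>
    have := h.flat (b + 1) (by omega) hb
    rw [add_sub_cancel_right] at this
    exact (ih (by omega)).trans this

theorem pos (h : IsSymmTrapezoid f c i) {k : ℤ} (hk : 0 ≤ k) (hkc : k ≤ c) : 0 < f k := by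
  have h1 := h.two_mul_le
  have h2 := h.nonneg
  have key : ∀ k, 0 ≤ k → 2 * k ≤ c → 0 < f k := fun k hk hkc => by
    have := h.lt (a := -1) (b := k) (by omega) (by omega) hk (by omega)
    rwa [h.zero (-1) (by omega)] at this
  rcases le_or_gt (2 * k) c with h3 | h3
  · exact key k hk h3
  · rw [← h.symm]
    exact key _ (by omega) (by omega)

theorem eq_zero_of_lt (h : IsSymmTrapezoid f c i) {k : ℤ} (hk : c < k) : f k = 0 := by
  rw [← h.symm, h.zero _ (by omega)]

/-- The sequence of a product with `[m]`. -/
theorem sum_shift (h : IsSymmTrapezoid f c i) {m : ℕ} (hm : 0 < m) :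
    IsSymmTrapezoid (fun k => ∑ j ∈ Finset.range m, f (k - j)) (c + m - 1)
      (min c (min (i + m - 1) ((c + m - 1) / 2))) := by
  have h1 := h.two_mul_le
  have h2 := h.nonneg
  -- Telescoping: the increment of the window sum is `f k - f (k - m)`. For `2 * k ≤ c + m` the
  -- point `k - m` is at least as far from `c / 2` as `k`. The increment is positive until `k`
  -- passes `c` (both values vanish), `k - m` reaches `i` (both lie on the plateau), or the new
  -- centre is reached.
  have hstep : ∀ k, ∑ j ∈ Finset.range m, f (k - j) =
      ∑ j ∈ Finset.range m, f (k - 1 - j) + (f k - f (k - m)) := fun k => by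
    have e1 := Finset.sum_range_succ (fun j : ℕ => f (k - j)) m
    have e2 := Finset.sum_range_succ' (fun j : ℕ => f (k - j)) m
    have e3 : ∑ j ∈ Finset.range m, f (k - 1 - j) =
        ∑ j ∈ Finset.range m, f (k - ((j + 1 : ℕ) : ℤ)) :=
      Finset.sum_congr rfl fun j _ => by congr 1; push_cast; ring
    rw [e3]
    simp only [Nat.cast_zero, sub_zero] at e1 e2
    linarith
  -- the reflected index `b` of `k` lies in the increasing half
  have hrefl : ∀ k, 2 * k ≤ c + m → ∃ b, f k = f b ∧ 2 * b ≤ c ∧ (b = k ∨ b = c - k) ∧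
      b ≤ k := fun k _ => by
    rcases le_or_gt (2 * k) c with h3 | h3
    · exact ⟨k, rfl, h3, Or.inl rfl, le_rfl⟩
    · exact ⟨c - k, (h.symm k).symm, by omega, Or.inr rfl, by omega⟩
  refine ⟨by omega, by omega, fun k hk => ?_, fun k => ?_, fun k hk0 hk => ?_,
    fun k hk hkc => ?_⟩
  · exact Finset.sum_eq_zero fun j _ => h.zero _ (by omega)
  · rw [← Finset.sum_range_reflect]
    refine Finset.sum_congr rfl fun j hj => ?_
    rw [Finset.mem_range] at hj
    rw [← h.symm]
    congr 1
    omega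
  · obtain ⟨b, hb, hbc, hb', hb''⟩ := hrefl k (by omega)
    have := h.lt (a := k - m) (b := b) (by omega) (by omega) (by omega) (by omega)
    rw [hstep k, hb]
    linarith
  · have key : f k = f (k - m) := by
      rcases lt_or_ge c k with h3 | h3
      · rw [h.eq_zero_of_lt h3, h.zero _ (by omega)]
      -- Here `k` and `k - m` are mirror images of each other.
      rcases eq_or_ne (2 * k) (c + m) with h4 | h4
      · rw [← h.symm k]
        congr 1
        omega
      obtain ⟨b, hb, hbc, hb', hb''⟩ := hrefl k (by omega)
      rw [hb]
      exact (h.eq_of_le (by omega) (by omega) (by omega)).symm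
    rw [hstep k, key]
    ring

/-- With a common centre neither summand decreases on the left half, so the sum rises strictly
wherever at least one of them does. -/
theorem add (hf : IsSymmTrapezoid f c i) (hg : IsSymmTrapezoid g c i') :
    IsSymmTrapezoid (fun k => f k + g k) c (max i i') := by
  have hf1 := hf.two_mul_le
  have hg1 := hg.two_mul_le
  have hf2 := hf.nonneg
  refine ⟨by omega, by omega, fun k hk => ?_, fun k => ?_, fun k hk0 hk => ?_,
    fun k hk hkc => ?_⟩
  · simp [hf.zero k hk, hg.zero k hk]
  · simp [hf.symm k, hg.symm k]
  · have h1 := hf.step_le (k := k) (by omega)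
    have h2 := hg.step_le (k := k) (by omega)
    rcases le_or_gt k i with h3 | h3
    · exact add_lt_add_of_lt_of_le (hf.rise k hk0 h3) h2
    · exact add_lt_add_of_le_of_lt h1 (hg.rise k hk0 (by omega))
  · simp only [hf.flat k (by omega) hkc, hg.flat k (by omega) hkc]

/-- Shifting a sequence on `{0, …, c - 2}` by one moves its centre to `c / 2`; this is the effect of
the factor `s` in the two-block polynomial. -/
theorem shift_add (hf : IsSymmTrapezoid f c i) (hg : IsSymmTrapezoid g (c - 2) i') :
    IsSymmTrapezoid (fun k => g (k - 1) + f k) c (max i (i' + 1)) := by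
  have hf1 := hf.two_mul_le
  have hg1 := hg.two_mul_le
  have hf2 := hf.nonneg
  refine ⟨by omega, by omega, fun k hk => ?_, fun k => ?_, fun k hk0 hk => ?_,
    fun k hk hkc => ?_⟩
  · simp [hf.zero k hk, hg.zero (k - 1) (by omega)]
  · rw [hf.symm k, ← hg.symm (k - 1)]
    congr 2
    ring
  · have h1 := hf.step_le (k := k) (by omega)
    have h2 := hg.step_le (k := k - 1) (by omega)
    rcases le_or_gt k i with h3 | h3
    · exact add_lt_add_of_le_of_lt h2 (hf.rise k hk0 h3)
    · exact add_lt_add_of_lt_of_le (hg.rise (k - 1) (by omega) (by omega)) h1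
  · simp only [hf.flat k (by omega) hkc, hg.flat (k - 1) (by omega) (by omega)]

end IsSymmTrapezoid

/-! ### Polynomials with symmetric trapezoidal coefficients -/

namespace Polynomial

/-- The coefficients of a polynomial, extended by zero to negative indices. -/
def intCoeff (p : Polynomial ℤ) (k : ℤ) : ℤ := if 0 ≤ k then p.coeff k.toNat else 0

theorem intCoeff_natCast (p : Polynomial ℤ) (k : ℕ) : p.intCoeff k = p.coeff k := by
  simp [intCoeff]

theorem intCoeff_add (p q : Polynomial ℤ) :
    (p + q).intCoeff = fun k => p.intCoeff k + q.intCoeff k := by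
  ext k
  by_cases h : 0 ≤ k <;> simp [intCoeff, h]

theorem intCoeff_X_pow_mul (p : Polynomial ℤ) (n : ℕ) (k : ℤ) :
    (X ^ n * p).intCoeff k = p.intCoeff (k - n) := by
  by_cases h : 0 ≤ k
  · lift k to ℕ using h
    rw [intCoeff_natCast, coeff_X_pow_mul', intCoeff]
    by_cases hn : n ≤ k
    · rw [if_pos hn, if_pos (by omega)]
      congr 1
      omega
    · rw [if_neg hn, if_neg (by omega)]
  · rw [intCoeff, if_neg h, intCoeff, if_neg (by omega)]

theorem intCoeff_X_mul (p : Polynomial ℤ) :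
    (X * p).intCoeff = fun k => p.intCoeff (k - 1) := by
  ext k
  simpa using intCoeff_X_pow_mul p 1 k

theorem intCoeff_sum {ι : Type*} (s : Finset ι) (p : ι → Polynomial ℤ) (k : ℤ) :
    (∑ j ∈ s, p j).intCoeff k = ∑ j ∈ s, (p j).intCoeff k := by
  by_cases h : 0 ≤ k <;> simp [intCoeff, h]

theorem intCoeff_qInt_mul (m : ℕ) (p : Polynomial ℤ) :
    (qInt m * p).intCoeff = fun k => ∑ j ∈ Finset.range m, p.intCoeff (k - j) := by
  ext k
  simp only [qInt, Finset.sum_mul, intCoeff_sum, intCoeff_X_pow_mul]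

theorem isSymmTrapezoid_intCoeff_one : IsSymmTrapezoid (1 : Polynomial ℤ).intCoeff 0 0 := by
  have h : ∀ k : ℤ, (1 : Polynomial ℤ).intCoeff k = if k = 0 then 1 else 0 := fun k => by
    rw [intCoeff, coeff_one]
    split_ifs <;> first | rfl | omega
  refine ⟨le_rfl, le_rfl, fun k hk => ?_, fun k => ?_, fun k hk0 hk => ?_, fun k hk hkc => ?_⟩
  · rw [h, if_neg (by omega)]
  · simp [h]
  · obtain rfl : k = 0 := by omega
    simp [h]
  · omega

theorem isSymmTrapezoid_qInt_mul {p : Polynomial ℤ} {c i : ℤ}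
    (h : IsSymmTrapezoid p.intCoeff c i) {m : ℕ} (hm : 0 < m) :
    IsSymmTrapezoid (qInt m * p).intCoeff (c + m - 1)
      (min c (min (i + m - 1) ((c + m - 1) / 2))) := by
  rw [intCoeff_qInt_mul]
  exact h.sum_shift hm

/-! ### Degree, symmetry and plateau read off from the trapezoid -/

section

variable {p : Polynomial ℤ} {c i : ℕ}

theorem natTrailingDegree_eq_zero_of_isSymmTrapezoid
    (h : IsSymmTrapezoid p.intCoeff c i) : p.natTrailingDegree = 0 := by
  have := h.pos (k := (0 : ℕ)) (by simp) (by simp)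
  rw [intCoeff_natCast] at this
  exact natTrailingDegree_eq_zero.2 (Or.inr this.ne')

theorem natDegree_eq_of_isSymmTrapezoid
    (h : IsSymmTrapezoid p.intCoeff c i) : p.natDegree = c := by
  refine natDegree_eq_of_le_of_coeff_ne_zero ?_ ?_
  · rw [natDegree_le_iff_coeff_eq_zero]
    intro N hN
    rw [← intCoeff_natCast]
    exact h.eq_zero_of_lt (by exact_mod_cast hN)
  · rw [← intCoeff_natCast]
    exact (h.pos (by simp) le_rfl).ne'

theorem span_eq_of_isSymmTrapezoid
    (h : IsSymmTrapezoid p.intCoeff c i) : p.span = c := by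
  rw [span, natDegree_eq_of_isSymmTrapezoid h, natTrailingDegree_eq_zero_of_isSymmTrapezoid h,
    Nat.sub_zero]

theorem shiftedCoeff_eq_of_isSymmTrapezoid
    (h : IsSymmTrapezoid p.intCoeff c i) (k : ℕ) : p.shiftedCoeff k = p.intCoeff k := by
  rw [shiftedCoeff, natTrailingDegree_eq_zero_of_isSymmTrapezoid h, add_zero, intCoeff_natCast]

theorem isSymmetric_of_isSymmTrapezoid
    (h : IsSymmTrapezoid p.intCoeff c i) : p.IsSymmetric := by
  intro k hk
  rw [span_eq_of_isSymmTrapezoid h] at hk ⊢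
  rw [shiftedCoeff_eq_of_isSymmTrapezoid h, shiftedCoeff_eq_of_isSymmTrapezoid h,
    Nat.cast_sub hk, h.symm]

theorem shiftedCoeff_ne_zero_of_isSymmTrapezoid
    (h : IsSymmTrapezoid p.intCoeff c i) {k : ℕ} (hk : k ≤ p.span) : p.shiftedCoeff k ≠ 0 := by
  rw [span_eq_of_isSymmTrapezoid h] at hk
  rw [shiftedCoeff_eq_of_isSymmTrapezoid h]
  exact (h.pos (by simp) (by exact_mod_cast hk)).ne'

theorem shiftedCoeff_lt_succ_of_isSymmTrapezoid
    (h : IsSymmTrapezoid p.intCoeff c i) {k : ℕ} (hk : k < i) :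
    p.shiftedCoeff k < p.shiftedCoeff (k + 1) := by
  have h1 := h.two_mul_le
  rw [shiftedCoeff_eq_of_isSymmTrapezoid h, shiftedCoeff_eq_of_isSymmTrapezoid h]
  exact h.lt (by omega) (by omega) (by omega) (by omega)

theorem shiftedCoeff_succ_lt_of_isSymmTrapezoid
    (h : IsSymmTrapezoid p.intCoeff c i) {k : ℕ} (hk : c - i ≤ k) (hkc : k < c) :
    p.shiftedCoeff (k + 1) < p.shiftedCoeff k := by
  have h1 := h.two_mul_le
  rw [shiftedCoeff_eq_of_isSymmTrapezoid h, shiftedCoeff_eq_of_isSymmTrapezoid h,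
    ← h.symm, ← h.symm (k : ℤ)]
  exact h.lt (by omega) (by omega) (by omega) (by omega)

theorem shiftedCoeff_eq_succ_of_isSymmTrapezoid
    (h : IsSymmTrapezoid p.intCoeff c i) {k : ℕ} (hk : i ≤ k) (hkc : k < c - i) :
    p.shiftedCoeff k = p.shiftedCoeff (k + 1) := by
  rw [shiftedCoeff_eq_of_isSymmTrapezoid h, shiftedCoeff_eq_of_isSymmTrapezoid h]
  rcases le_or_gt (2 * (k + 1)) (c + 1) with h2 | h2
  · exact h.eq_of_le (by omega) (by omega) (by omega)
  · rw [← h.symm, ← h.symm ((k + 1 : ℕ) : ℤ)]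
    exact (h.eq_of_le (by omega) (by omega) (by omega)).symm

theorem isTrapezoidal_of_isSymmTrapezoid
    (h : IsSymmTrapezoid p.intCoeff c i) : p.IsTrapezoidal := by
  have h1 := h.two_mul_le
  refine ⟨i, c - i, by omega, ?_, fun k hk => shiftedCoeff_lt_succ_of_isSymmTrapezoid h hk,
    fun k hk hkc => shiftedCoeff_eq_succ_of_isSymmTrapezoid h hk hkc, fun k hk hkc => ?_⟩
  · rw [span_eq_of_isSymmTrapezoid h]
    omega
  · rw [span_eq_of_isSymmTrapezoid h] at hkc
    exact shiftedCoeff_succ_lt_of_isSymmTrapezoid h hk hkc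

theorem isStableLength_of_isSymmTrapezoid
    (h : IsSymmTrapezoid p.intCoeff c i) : p.IsStableLength (c - 2 * i) := by
  have h1 := h.two_mul_le
  constructor
  · refine ⟨i, by rw [span_eq_of_isSymmTrapezoid h]; omega, fun m => ?_⟩
    induction m with
    | zero => simp
    | succ m ih =>
      intro hm
      rw [← ih (by omega), ← add_assoc]
      exact (shiftedCoeff_eq_succ_of_isSymmTrapezoid h (by omega) (by omega)).symm
  · rintro l ⟨k₀, hk₀, hl⟩
    rw [span_eq_of_isSymmTrapezoid h] at hk₀
    by_contra! hlt
    -- A longer constant run either starts in the rising part or ends in the falling part; its first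
    -- or last step gives the contradiction.
    rcases lt_or_ge k₀ i with h2 | h2
    · have := shiftedCoeff_lt_succ_of_isSymmTrapezoid h h2
      rw [hl 1 (by omega)] at this
      exact this.false
    · have := shiftedCoeff_succ_lt_of_isSymmTrapezoid h (k := k₀ + (l - 1)) (by omega) (by omega)
      rw [hl (l - 1) (by omega), add_assoc, hl (l - 1 + 1) (by omega)] at this
      exact this.false

end

end Polynomial

-- Of the three rises only that of `d` has to be known: the rise of the whole sum is at least as
-- large, so its plateau is no longer.
open Polynomial in
theorem exists_isSymmTrapezoid_twoBlockPolynomial {p₁ q₁ r₁ p₂ q₂ r₂ : ℕ} (hp₁ : 0 < p₁)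
    (hq₁ : 0 < q₁) (hr₁ : 0 < r₁) (hp₂ : 0 < p₂) (hq₂ : 0 < q₂) (hr₂ : 0 < r₂) :
    ∃ c i : ℕ, IsSymmTrapezoid (twoBlockPolynomial p₁ q₁ r₁ p₂ q₂ r₂).intCoeff c i ∧
      ((c - 2 * i : ℕ) : ℤ) ≤
        |((q₁ + q₂ : ℕ) : ℤ) - 1 - (((p₁ + p₂ : ℕ) : ℤ) - 1 + (((r₁ + r₂ : ℕ) : ℤ) - 1))| := by
  have h1 := isSymmTrapezoid_intCoeff_one
  have hc : ∀ {f c c' i}, IsSymmTrapezoid f c i → c = c' → IsSymmTrapezoid f c' i :=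
    fun h e => e ▸ h
  obtain ⟨n, hn⟩ : ∃ n : ℕ, n = p₁ + p₂ + (q₁ + q₂) + (r₁ + r₂) - 3 := ⟨_, rfl⟩
  obtain ⟨a, ha⟩ : ∃ a, a = qInt q₁ * (qInt q₂ * (qInt p₁ * (qInt p₂ *
    (qInt (r₁ + r₂) * 1)))) := ⟨_, rfl⟩
  obtain ⟨b, hb⟩ : ∃ b, b = qInt q₁ * (qInt q₂ * (qInt r₁ * (qInt r₂ *
    (qInt (p₁ + p₂) * 1)))) := ⟨_, rfl⟩
  obtain ⟨d, hd⟩ : ∃ d, d = qInt (p₁ + p₂) * (qInt (q₁ + q₂) * (qInt (r₁ + r₂) * 1)) := ⟨_, rfl⟩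
  have hpoly : twoBlockPolynomial p₁ q₁ r₁ p₂ q₂ r₂ = X * (a + b) + d := by
    rw [twoBlockPolynomial, ha, hb, hd]
    ring
  obtain ⟨i₁, hA⟩ : ∃ i, IsSymmTrapezoid a.intCoeff (n - 2) i := by
    rw [ha]
    exact ⟨_, hc (isSymmTrapezoid_qInt_mul (isSymmTrapezoid_qInt_mul (isSymmTrapezoid_qInt_mul
      (isSymmTrapezoid_qInt_mul (isSymmTrapezoid_qInt_mul h1 (m := r₁ + r₂) (by omega))
        hp₂) hp₁) hq₂) hq₁) (by omega)⟩
  obtain ⟨i₂, hB⟩ : ∃ i, IsSymmTrapezoid b.intCoeff (n - 2) i := by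
    rw [hb]
    exact ⟨_, hc (isSymmTrapezoid_qInt_mul (isSymmTrapezoid_qInt_mul (isSymmTrapezoid_qInt_mul
      (isSymmTrapezoid_qInt_mul (isSymmTrapezoid_qInt_mul h1 (m := p₁ + p₂) (by omega))
        hr₂) hr₁) hq₂) hq₁) (by omega)⟩
  -- With `P, Q, R` the three sums of exponents, `n - 2 * i₃` is the maximum of `P - Q - R + 1`, `|Q
  -- - R| - P + 1` and the parity of `n`. Each is at most `|Q - P - R + 1|`, which has the parity of
  -- `n`.
  obtain ⟨i₃, hC, hi₃⟩ : ∃ i, IsSymmTrapezoid d.intCoeff n i ∧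
      (n : ℤ) - 2 * i ≤
        |((q₁ + q₂ : ℕ) : ℤ) - 1 - (((p₁ + p₂ : ℕ) : ℤ) - 1 + (((r₁ + r₂ : ℕ) : ℤ) - 1))| := by
    rw [hd]
    exact ⟨_, hc (isSymmTrapezoid_qInt_mul (isSymmTrapezoid_qInt_mul
      (isSymmTrapezoid_qInt_mul h1 (m := r₁ + r₂) (by omega)) (m := q₁ + q₂) (by omega))
        (m := p₁ + p₂) (by omega)) (by omega), by rw [le_abs]; omega⟩
  have hS := hC.shift_add (hA.add hB)
  have hcoeff : (twoBlockPolynomial p₁ q₁ r₁ p₂ q₂ r₂).intCoeff =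
      fun k => a.intCoeff (k - 1) + b.intCoeff (k - 1) + d.intCoeff k := by
    rw [hpoly, intCoeff_add, intCoeff_X_mul, intCoeff_add]
  rw [← hcoeff] at hS
  have hn₃ := hC.nonneg
  have hS' := hS.two_mul_le
  refine ⟨n, (max i₃ (max i₁ i₂ + 1)).toNat, ?_, ?_⟩
  · rwa [Int.toNat_of_nonneg (by omega)]
  · refine le_trans ?_ hi₃
    omega

/-! ### The signature of a closed alternating braid -/

namespace BraidWord

variable {k : ℕ} {w : BraidWord k}

namespace SeifertLoop

/-- The second band is the next one in the same column, hence determined by the first. -/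
theorem eq_of_fst_eq {x y : w.SeifertLoop} (h : x.1.1 = y.1.1) : x = y := by
  obtain ⟨⟨a, b⟩, hab, hc, hn⟩ := x
  obtain ⟨⟨a', b'⟩, hab', hc', hn'⟩ := y
  obtain rfl : a = a' := h
  rcases lt_trichotomy b b' with hb | rfl | hb
  · exact absurd hc.symm (hn' b hab hb)
  · rfl
  · exact absurd hc'.symm (hn b' hab' hb)

theorem eq_of_snd_eq {x y : w.SeifertLoop} (h : x.1.2 = y.1.2) : x = y := by
  obtain ⟨⟨a, b⟩, hab, hc, hn⟩ := x
  obtain ⟨⟨a', b'⟩, hab', hc', hn'⟩ := y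
  obtain rfl : b = b' := h
  rcases lt_trichotomy a a' with ha | rfl | ha
  · exact absurd (hc'.trans hc.symm) (hn a' ha hab')
  · rfl
  · exact absurd (hc.trans hc'.symm) (hn' a ha hab)

/-- The boundary of a loop in the space spanned by the bands. -/
def boundary (x : w.SeifertLoop) (a : Fin w.length) : ℝ :=
  (if x.1.1 = a then 1 else 0) - (if x.1.2 = a then 1 else 0)

theorem sum_boundary_mul (x y : w.SeifertLoop) :
    ∑ a, x.boundary a * y.boundary a =
      (if x.1.1 = y.1.1 then 1 else 0) - (if x.1.1 = y.1.2 then 1 else 0) -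
        (if x.1.2 = y.1.1 then 1 else 0) + (if x.1.2 = y.1.2 then 1 else 0) := by
  simp only [boundary, sub_mul, mul_sub, Finset.sum_sub_distrib, ite_mul, one_mul, zero_mul,
    Finset.sum_ite_eq, Finset.mem_univ, if_true]
  simp only [eq_comm (a := y.1.1), eq_comm (a := y.1.2)]
  ring

/-- The boundaries of the loops are linearly independent. -/
theorem exists_sum_mul_boundary_ne_zero {v : w.SeifertLoop → ℝ} (hv : v ≠ 0) :
    ∃ a, ∑ x, v x * x.boundary a ≠ 0 := by
  obtain ⟨x₀, hx₀⟩ : ∃ x, v x ≠ 0 := by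
    by_contra! h
    exact hv (funext h)
  -- Take the loop in the support of `v` with the earliest first band: no other loop in the support
  -- meets that band.
  obtain ⟨x, hx, hmin⟩ := Finset.exists_min_image
    (Finset.univ.filter fun x : w.SeifertLoop => v x ≠ 0) (fun x => x.1.1) ⟨x₀, by simpa using hx₀⟩
  rw [Finset.mem_filter] at hx
  refine ⟨x.1.1, ?_⟩
  rw [Finset.sum_eq_single x]
  · simpa [boundary, x.2.1.ne'] using hx.2
  · intro y _ hyx
    by_cases hy : v y = 0
    · rw [hy, zero_mul]
    · have h1 := hmin y (by simpa using hy)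
      have h2 : y.1.1 ≠ x.1.1 := fun h => hyx (eq_of_fst_eq h)
      have h3 : y.1.2 ≠ x.1.1 := fun h => absurd y.2.1 (by rw [h]; exact h1.not_gt)
      simp [boundary, h2, h3]
  · simp

end SeifertLoop

open SeifertLoop

/-- Within one sign class of an alternating word, the symmetrized Seifert matrix is, up to sign,
the Gram matrix of the boundaries. -/
theorem seifertMatrix_add_transpose_apply
    (hsame : ∀ a b, (w.get a).1 = (w.get b).1 → (w.get a).2 = (w.get b).2)
    (hadj : ∀ a b, ((w.get a).1 : ℕ) + 1 = (w.get b).1 → (w.get a).2 ≠ (w.get b).2)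
    {x y : w.SeifertLoop} (hxy : (w.get x.1.1).2 = (w.get y.1.1).2) :
    ((w.seifertMatrix x y + w.seifertMatrix y x : ℤ) : ℝ) =
      -(w.crossingSign x.1.1 : ℝ) * ∑ a, x.boundary a * y.boundary a := by
  have hsign : ∀ z : w.SeifertLoop, w.crossingSign z.1.2 = w.crossingSign z.1.1 := fun z => by
    rw [crossingSign, crossingSign, hsame z.1.1 z.1.2 z.2.2.1]
  have hs : w.crossingSign y.1.1 = w.crossingSign x.1.1 := by
    rw [crossingSign, crossingSign, hxy]
  have hval : w.crossingSign x.1.1 = 1 ∨ w.crossingSign x.1.1 = -1 := by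
    rw [crossingSign]
    split_ifs <;> simp
  rw [sum_boundary_mul]
  by_cases h : x = y
  · subst h
    have h1 := x.2.1.ne
    have h2 := x.2.1.ne'
    rcases hval with hval | hval <;>
      simp [seifertMatrix, hsign, hval, h1, h2] <;> norm_num
  have h' : y ≠ x := fun e => h e.symm
  have h1 : x.1.1 ≠ y.1.1 := fun e => h (eq_of_fst_eq e)
  have h2 : x.1.2 ≠ y.1.2 := fun e => h (eq_of_snd_eq e)
  have hx := x.2.1
  have hy := y.2.1
  by_cases h3 : x.1.2 = y.1.1
  · have h4 : x.1.1 ≠ y.1.2 := by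
      intro e
      rw [h3] at hx
      rw [← e] at hy
      exact absurd hx hy.not_gt
    have e1 : w.seifertMatrix x y = if w.crossingSign x.1.2 = 1 then 1 else 0 := by
      rw [seifertMatrix, if_neg h, if_pos h3]
    have e2 : w.seifertMatrix y x = if w.crossingSign y.1.1 = 1 then 0 else -1 := by
      rw [seifertMatrix, if_neg h', if_neg (Ne.symm h4), if_pos h3]
    rw [e1, e2, hsign, hs, if_neg h1, if_neg h4, if_pos h3, if_neg h2]
    rcases hval with hval | hval <;> simp [hval]
  by_cases h4 : x.1.1 = y.1.2
  · have e1 : w.seifertMatrix x y = if w.crossingSign x.1.1 = 1 then 0 else -1 := by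
      rw [seifertMatrix, if_neg h, if_neg h3, if_pos h4.symm]
    have e2 : w.seifertMatrix y x = if w.crossingSign y.1.2 = 1 then 1 else 0 := by
      rw [seifertMatrix, if_neg h', if_pos h4.symm]
    rw [e1, e2, hsign, hs, if_neg h1, if_pos h4, if_neg h3, if_neg h2]
    rcases hval with hval | hval <;> simp [hval]
  -- Loops of equal sign never lie in adjacent columns, so the interleaving entries do not occur.
  have h5 : (x.column : ℕ) + 1 ≠ y.column := fun e => hadj _ _ e hxy
  have h6 : (y.column : ℕ) + 1 ≠ x.column := fun e => hadj _ _ e hxy.symm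
  simp [seifertMatrix, h, h', h1, h2, h3, h4, Ne.symm h4, h5, h6]

/-- The quadratic form of the symmetrized Seifert matrix. -/
noncomputable def seifertForm (w : BraidWord k) : QuadraticForm ℝ (w.SeifertLoop → ℝ) :=
  ((w.seifertMatrix + w.seifertMatrix.transpose).map (Int.cast : ℤ → ℝ)).toQuadraticForm'

theorem seifertForm_apply (v : w.SeifertLoop → ℝ) :
    w.seifertForm v = ∑ x, ∑ y, v x * v y *
      ((w.seifertMatrix x y + w.seifertMatrix y x : ℤ) : ℝ) := by
  simp only [seifertForm, Matrix.toQuadraticForm', LinearMap.BilinMap.toQuadraticMap_apply,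
    Matrix.toLinearMap₂'_apply', dotProduct, Matrix.mulVec, Finset.mul_sum, Matrix.map_apply,
    Matrix.add_apply, Matrix.transpose_apply]
  exact Finset.sum_congr rfl fun x _ => Finset.sum_congr rfl fun y _ => by ring

/-- On one sign class the form is, up to sign, the squared norm of the boundary of `v`; definiteness
then follows from independence of the boundaries. -/
theorem seifertForm_eq_of_support
    (hsame : ∀ a b, (w.get a).1 = (w.get b).1 → (w.get a).2 = (w.get b).2)
    (hadj : ∀ a b, ((w.get a).1 : ℕ) + 1 = (w.get b).1 → (w.get a).2 ≠ (w.get b).2)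
    (e : Bool) {v : w.SeifertLoop → ℝ} (hv : ∀ x : w.SeifertLoop, (w.get x.1.1).2 ≠ e → v x = 0) :
    w.seifertForm v = (if e then -1 else 1) * ∑ a, (∑ x, v x * x.boundary a) ^ 2 := by
  have hterm : ∀ x y, v x * v y * ((w.seifertMatrix x y + w.seifertMatrix y x : ℤ) : ℝ) =
      (if e then -1 else 1) * ∑ a, (v x * x.boundary a) * (v y * y.boundary a) := by
    intro x y
    by_cases hx : (w.get x.1.1).2 = e
    · by_cases hy : (w.get y.1.1).2 = e
      · rw [seifertMatrix_add_transpose_apply hsame hadj (hx.trans hy.symm), crossingSign, hx]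
        simp only [mul_mul_mul_comm (v x), ← Finset.mul_sum]
        cases e <;> simp
      · simp [hv y hy]
    · simp [hv x hx]
  rw [seifertForm_apply]
  simp only [hterm, ← Finset.mul_sum]
  congr 1
  simp only [sq, Finset.sum_mul_sum]
  rw [Finset.sum_comm' (t' := Finset.univ) (s' := fun _ => Finset.univ) (by simp)]
  rw [Finset.sum_congr rfl fun y _ => Finset.sum_comm, Finset.sum_comm]
  exact Finset.sum_congr rfl fun a _ => Finset.sum_comm

/-- The signature of the closure of an alternating braid word. -/
theorem signature_eq_of_alternating
    (hsame : ∀ a b, (w.get a).1 = (w.get b).1 → (w.get a).2 = (w.get b).2)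
    (hadj : ∀ a b, ((w.get a).1 : ℕ) + 1 = (w.get b).1 → (w.get a).2 ≠ (w.get b).2) :
    w.signature = ({x : w.SeifertLoop | (w.get x.1.1).2 = false}.ncard : ℤ) -
      ({x : w.SeifertLoop | (w.get x.1.1).2 = true}.ncard : ℤ) := by
  have hpos : ∀ e : Bool, ∀ v ∈ Pi.spanSubset ℝ {x : w.SeifertLoop | (w.get x.1.1).2 = e},
      v ≠ 0 → 0 < (if e then -1 else 1) * w.seifertForm v := by
    intro e v hv hv0
    rw [seifertForm_eq_of_support hsame hadj e (Pi.mem_spanSubset_iff.mp hv), ← mul_assoc]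
    obtain ⟨a, ha⟩ := exists_sum_mul_boundary_ne_zero hv0
    have : 0 < ∑ a, (∑ x, v x * x.boundary a) ^ 2 :=
      Finset.sum_pos' (fun _ _ => sq_nonneg _) ⟨a, Finset.mem_univ _, by positivity⟩
    cases e <;> simpa using this
  have h1 : {x : w.SeifertLoop | (w.get x.1.1).2 = false}.ncard ≤ sigPos w.seifertForm := by
    rw [← Pi.dim_spanSubset (R := ℝ)]
    refine le_sigPos_of_posDef _ fun v hv => ?_
    simpa using hpos false v.1 v.2 (by simpa using hv)
  have h2 : {x : w.SeifertLoop | (w.get x.1.1).2 = true}.ncard ≤ sigNeg w.seifertForm := by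
    rw [← Pi.dim_spanSubset (R := ℝ)]
    refine le_sigNeg_of_negDef _ fun v hv => ?_
    simpa using hpos true v.1 v.2 (by simpa using hv)
  -- The two lower bounds already add up to the full dimension, so both are equalities. The entries
  -- between the two sign classes play no role.
  have h3 := QuadraticForm.sigPos_add_sigNeg_add_radical (Q := w.seifertForm)
  rw [Module.finrank_fintype_fun_eq_card, ← Nat.card_eq_fintype_card,
    ← Set.ncard_add_ncard_compl {x : w.SeifertLoop | (w.get x.1.1).2 = false}] at h3
  have h4 : {x : w.SeifertLoop | (w.get x.1.1).2 = false}ᶜ =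
      {x : w.SeifertLoop | (w.get x.1.1).2 = true} := by
    ext x
    simp
  rw [h4] at h3
  have h5 : w.signature = (sigPos w.seifertForm : ℤ) - (sigNeg w.seifertForm : ℤ) := rfl
  omega

/-- A column with `n ≥ 1` bands carries `n - 1` loops. -/
theorem ncard_column_add_one (i : Fin k) (hi : ∃ a, (w.get a).1 = i) :
    {x : w.SeifertLoop | x.column = i}.ncard + 1 = (w.map Prod.fst).count i := by
  have hcount : ∀ l : BraidWord k, {a : Fin l.length | (l.get a).1 = i}.ncard =
      (l.map Prod.fst).count i := by
    intro l
    rw [Set.ncard_eq_toFinset_card', Set.toFinset_ofPred]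
    induction l with
    | nil => simp
    | cons u l ih =>
      rw [List.map_cons, List.count_cons, ← ih]
      refine (Fin.card_filter_univ_succ fun a => ((u :: l).get a).1 = i).trans ?_
      simp only [List.get_cons_zero, List.get_cons_succ', beq_iff_eq]
      split_ifs <;> rfl
  rw [← hcount]
  obtain ⟨a₀, ha₀⟩ := hi
  obtain ⟨m, hm, hmin⟩ := Finset.exists_min_image
    (Finset.univ.filter fun a : Fin w.length => (w.get a).1 = i) id ⟨a₀, by simpa using ha₀⟩
  simp only [Finset.mem_filter, Finset.mem_univ, true_and, id] at hm hmin
  -- A loop is recorded by its second band, which can be any band of the column except the first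
  -- one, `m`. The loop ending at `b` starts at the last band of the column before `b`.
  have himage : (fun x : w.SeifertLoop => x.1.2) '' {x | x.column = i} =
      {a | (w.get a).1 = i} \ {m} := by
    ext b
    simp only [Set.mem_image, Set.mem_ofPred_eq, Set.mem_sdiff, Set.mem_singleton_iff]
    constructor
    · rintro ⟨x, hx, rfl⟩
      refine ⟨x.2.2.1.symm.trans hx, fun e => ?_⟩
      have h1 := hmin x.1.1 hx
      have h2 := x.2.1
      rw [e] at h2
      exact absurd h1 h2.not_ge
    · rintro ⟨hb, hbm⟩
      obtain ⟨a, ha, hmax⟩ := Finset.exists_max_image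
        (Finset.univ.filter fun a : Fin w.length => (w.get a).1 = i ∧ a < b) id
        ⟨m, by simpa using ⟨hm, lt_of_le_of_ne (hmin b hb) (Ne.symm hbm)⟩⟩
      simp only [Finset.mem_filter, Finset.mem_univ, true_and, id] at ha hmax
      refine ⟨⟨(a, b), ha.2, ha.1.trans hb.symm, fun c hac hcb hc => ?_⟩, ha.1, rfl⟩
      exact absurd (hmax c ⟨hc.trans ha.1, hcb⟩) hac.not_ge
  rw [← Set.ncard_image_of_injective _ (fun x y h => eq_of_snd_eq h), himage,
    Set.ncard_sdiff_singleton_add_one (s := {a | (w.get a).1 = i}) hm]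

end BraidWord

theorem signature_twoBlockWord {p₁ q₁ r₁ p₂ q₂ r₂ : ℕ} (hp₁ : 0 < p₁) (hq₁ : 0 < q₁)
    (hr₁ : 0 < r₁) :
    (twoBlockWord p₁ q₁ r₁ p₂ q₂ r₂).signature = ((q₁ + q₂ : ℕ) : ℤ) - 1 -
      (((p₁ + p₂ : ℕ) : ℤ) - 1 + (((r₁ + r₂ : ℕ) : ℤ) - 1)) := by
  obtain ⟨w, hw⟩ : ∃ w, w = twoBlockWord p₁ q₁ r₁ p₂ q₂ r₂ := ⟨_, rfl⟩
  rw [← hw]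
  -- Signs depend only on the column, the middle one being negative; both alternation hypotheses
  -- follow from this.
  have hmem : ∀ u ∈ w, u.2 = decide (u.1 ≠ 1) := by
    intro u hu
    simp only [hw, twoBlockWord, List.mem_append, List.mem_replicate] at hu
    rcases hu with ((((⟨-, rfl⟩ | ⟨-, rfl⟩) | ⟨-, rfl⟩) | ⟨-, rfl⟩) | ⟨-, rfl⟩) | ⟨-, rfl⟩ <;> rfl
  have hget : ∀ a, (w.get a).2 = decide ((w.get a).1 ≠ 1) := fun a => hmem _ (List.get_mem w a)
  have hcol : ∀ u ∈ w, ∃ a, (w.get a).1 = u.1 := fun u hu => by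
    obtain ⟨a, ha⟩ := List.mem_iff_get.mp hu
    exact ⟨a, by rw [ha]⟩
  have h0 := BraidWord.ncard_column_add_one (w := w) 0
    (hcol (0, true) (by simp [hw, twoBlockWord, hp₁.ne']))
  have h1 := BraidWord.ncard_column_add_one (w := w) 1
    (hcol (1, false) (by simp [hw, twoBlockWord, hq₁.ne']))
  have h2 := BraidWord.ncard_column_add_one (w := w) 2
    (hcol (2, true) (by simp [hw, twoBlockWord, hr₁.ne']))
  have c0 : (w.map Prod.fst).count 0 = p₁ + p₂ := by
    simp [hw, twoBlockWord, List.count_replicate]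
  have c1 : (w.map Prod.fst).count 1 = q₁ + q₂ := by
    simp [hw, twoBlockWord, List.count_replicate]
  have c2 : (w.map Prod.fst).count 2 = r₁ + r₂ := by
    simp [hw, twoBlockWord, List.count_replicate]
  rw [BraidWord.signature_eq_of_alternating]
  · have hneg : {x : w.SeifertLoop | (w.get x.1.1).2 = false} =
        {x : w.SeifertLoop | x.column = 1} := by
      ext x
      rw [Set.mem_ofPred_eq, Set.mem_ofPred_eq, hget, BraidWord.SeifertLoop.column,
        decide_eq_false_iff_not, not_not]
    have hpos : {x : w.SeifertLoop | (w.get x.1.1).2 = true} =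
        {x : w.SeifertLoop | x.column = 0} ∪ {x : w.SeifertLoop | x.column = 2} := by
      ext x
      simp only [hget, BraidWord.SeifertLoop.column, Set.mem_ofPred_eq, Set.mem_union]
      generalize (w.get x.1.1).1 = j
      fin_cases j <;> simp
    have hdisj : Disjoint {x : w.SeifertLoop | x.column = 0}
        {x : w.SeifertLoop | x.column = 2} := by
      rw [Set.disjoint_left]
      intro x hx hx'
      rw [Set.mem_ofPred_eq] at hx hx'
      rw [hx] at hx'
      exact absurd hx' (by decide)
    rw [hneg, hpos, Set.ncard_union_eq hdisj]
    omega
  · intro a b hab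
    rw [hget, hget, hab]
  · intro a b
    rw [hget, hget]
    generalize (w.get a).1 = i
    generalize (w.get b).1 = j
    revert i j
    decide

theorem mainTheorem3 (p₁ q₁ r₁ p₂ q₂ r₂ : ℕ) (hp₁ : 0 < p₁) (hq₁ : 0 < q₁) (hr₁ : 0 < r₁)
    (hp₂ : 0 < p₂) (hq₂ : 0 < q₂) (hr₂ : 0 < r₂) :
    -- the Alexander polynomial, up to a unit of `ℤ[t^{1/2}, t^{-1/2}]`, where `s = -t`
    Associated (alexanderPolynomial (twoBlockWord p₁ q₁ r₁ p₂ q₂ r₂).toBraid)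
      (Polynomial.aeval (-(tVar : LaurentPolynomial ℤ))
        (twoBlockPolynomial p₁ q₁ r₁ p₂ q₂ r₂)) ∧
    -- it is symmetric and trapezoidal with nonzero coefficients
    (twoBlockPolynomial p₁ q₁ r₁ p₂ q₂ r₂).IsSymmetric ∧
    (∀ k ≤ (twoBlockPolynomial p₁ q₁ r₁ p₂ q₂ r₂).span,
      (twoBlockPolynomial p₁ q₁ r₁ p₂ q₂ r₂).shiftedCoeff k ≠ 0) ∧
    (twoBlockPolynomial p₁ q₁ r₁ p₂ q₂ r₂).IsTrapezoidal ∧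
    -- the length of its stable part is at most the absolute value of the signature
    ∃ l : ℕ, (twoBlockPolynomial p₁ q₁ r₁ p₂ q₂ r₂).IsStableLength l ∧
      (l : ℤ) ≤ |(twoBlockWord p₁ q₁ r₁ p₂ q₂ r₂).signature| := by
  obtain ⟨c, i, h, hle⟩ :=
    exists_isSymmTrapezoid_twoBlockPolynomial hp₁ hq₁ hr₁ hp₂ hq₂ hr₂
  refine ⟨associated_alexanderPolynomial_twoBlockWord p₁ q₁ r₁ p₂ q₂ r₂,
    Polynomial.isSymmetric_of_isSymmTrapezoid h,
    fun k hk => Polynomial.shiftedCoeff_ne_zero_of_isSymmTrapezoid h hk,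
    Polynomial.isTrapezoidal_of_isSymmTrapezoid h, c - 2 * i,
    Polynomial.isStableLength_of_isSymmTrapezoid h, ?_⟩
  rw [signature_twoBlockWord hp₁ hq₁ hr₁]
  exact hle
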